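/- Fix an integer $m\ge 2$ of colours. A dimer configuration on a segment of size $n\ge1$ places at each position $1,\dots,n$ at most one dimer, coloured with one of the $m$ colours, such that dimers at adjacent positions have different colours; its weight is $r^{b}s^{a}$, where $b$ is the number of dimers and $a$ is the sum of their positions. Fix two distinct colours $c\neq c'$. Let $Z_n^{\Phi c}(m,r,s)$ be the sum of the weights of the configurations that have no dimer at position $1$ and a dimer of colour $c$ at position $n$, let $Z_n^{c'c}(m,r,s)$ be the sum of the weights of those that have a dimer of colour $c'$ at position $1$ and a dimer of colour $c$ at position $n$, and put $$G_n^{(2)}(m,r,s):=Z_n^{\Phi c}(m,r,s)+(m-1)\,Z_n^{c'c}(m,r,s)$$ (by symmetry this does not depend on the choice of $c\ne c'$). Let $$f^{R}(a,b):=\sum_{n=-\infty}^{\infty}a^{n(n+1)/2}b^{n(n-1)/2}$$ be Ramanujan's general theta function. Let $s$ be a formal variable and take limits and infinite sums in the $s$-adic topology of the field $\mathbb{Q}((s))$ of formal Laurent series. **Theorem.** The series $f^{R}(s^{6},s^{10})$ and $f^{R}(-s,-s^{3})$ converge, the latter is nonzero, and the reversed generating functions $G_n^{(2)}(2,1,1/s)$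 satisfy $$\lim_{n\to\infty,\ n\text{ even}}s^{n(n+1)/2}\,G_n^{(2)}(2,1,1/s)=\frac{f^{R}(s^{6},s^{10})}{f^{R}(-s,-s^{3})},$$ $$\lim_{n\to\infty,\ n\text{ odd}}s^{n(n+1)/2}\,G_n^{(2)}(2,1,1/s)=\frac{f^{R}(s^{6},s^{10})}{f^{R}(-s,-s^{3})}-1 .$$ -/

import Mathlib

/-- A state of the segment of length `n` with `m` colours: the entry `d i` describes position
`i + 1`; it is `none` if there is no dimer there and `some c` if there is a dimer of colour `c`. -/
abbrev DimerState (n m : ℕ) : Type := Fin n → Option (Fin m)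

/-- A state is a dimer configuration if no two adjacent positions carry dimers of the same
colour. -/
def DimerState.IsConfiguration {n m : ℕ} (d : DimerState n m) : Prop :=
  ∀ i j : Fin n, (j : ℕ) = (i : ℕ) + 1 → ∀ c : Fin m, d i = some c → d j ≠ some c

instance {n m : ℕ} (d : DimerState n m) : Decidable d.IsConfiguration := by
  unfold DimerState.IsConfiguration
  infer_instance

/-- The positions (as elements of `Fin n`) occupied by a dimer. -/
def DimerState.occupied {n m : ℕ} (d : DimerState n m) : Finset (Fin n) :=
  Finset.univ.filter fun i => (d i).isSome = true

/-- The weight `r ^ (number of dimers) * s ^ (sum of the positions of the dimers)`. -/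
def DimerState.weight {R : Type*} [CommSemiring R] {n m : ℕ} (r s : R) (d : DimerState n m) : R :=
  r ^ d.occupied.card * s ^ (∑ i ∈ d.occupied, ((i : ℕ) + 1))

/-- The generating function `Z_n^{αβ}(m, r, s)`, `n ≥ 1`: the weighted sum over the dimer
configurations on a segment of size `n` with `m` colours whose first site is in the state `α` and
whose last site is in the state `β`. -/
def dimerZ {R : Type*} [CommSemiring R] (n m : ℕ) (α β : Option (Fin m)) (r s : R) : R :=
  ∑ d ∈ (Finset.univ : Finset (DimerState n m)).filter (fun d =>
      d.IsConfiguration ∧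
      (∀ i : Fin n, (i : ℕ) = 0 → d i = α) ∧
      (∀ i : Fin n, (i : ℕ) + 1 = n → d i = β)),
    d.weight r s

/-- The generating function `G_n^{(2)}(m, r, s) = Z_n^{Φc} + (m - 1) Z_n^{c'c}`, where `Φ` is the
absence of a dimer and `c ≠ c'` are two fixed colours. -/
def dimerG2 {R : Type*} [CommRing R] (n m : ℕ) (c c' : Fin m) (r s : R) : R :=
  dimerZ n m none (some c) r s + ((m : R) - 1) * dimerZ n m (some c') (some c) r s

/-- The terms `a ^ (n(n+1)/2) * b ^ (n(n-1)/2)` of Ramanujan's general theta function (both integer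
divisions are exact). -/
def ramanujanThetaTerm {K : Type*} [Field K] (a b : K) (n : ℤ) : K :=
  a ^ (n * (n + 1) / 2) * b ^ (n * (n - 1) / 2)

/-- Ramanujan's general theta function `f^R(a, b) = ∑_{n ∈ ℤ} a ^ (n(n+1)/2) b ^ (n(n-1)/2)`. -/
noncomputable def ramanujanTheta {K : Type*} [Field K] [TopologicalSpace K] (a b : K) : K :=
  ∑' n : ℤ, ramanujanThetaTerm a b n

/-- The formal variable `s` of the field `ℚ((s))` of formal Laurent series; that field carries
Mathlib's `s`-adic topology. -/
noncomputable def formalS : LaurentSeries ℚ := HahnSeries.single 1 1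

/-!
Put `q = s`. Multiplying by `s ^ (n(n+1)/2)` and inverting `s` turns the weight of a configuration
into `q` to the sum of the *empty* positions. Let `A_n`, `B_n`, `C_n` be the resulting generating
functions for the configurations whose last site carries `c`, carries `c'`, or is empty, and whose
first site is empty or carries `c'`. Removing the last site gives
`A_{n+1} = B_n + C_n`, `B_{n+1} = A_n + C_n`, `C_{n+1} = q^{n+1} (A_n + B_n + C_n)`.
Hence `A_n - B_n = (-1)^n`, which accounts for the dependence on the parity of `n`, and it remains
to find the limit of `A_n + B_n`.

Let `S(y, x) = ∑_k y^k q^{k(k+1)/2} (-x; q)_k / (q; q)_k` (`lebesgueSum`). The relation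
`S(y, 1) - S(yq, 1) = yq (S(yq, 1) + S(yq², 1))` says that
`S(q^n, 1) (A_n + B_n) + (S(q^n, 1) + S(q^{n+1}, 1)) C_n` does not depend on `n`
(`reversedG_invariant`); as `S(q^n, 1) → 1` and `C_n → 0`, the limit is `S(1, 1)`
(`tendsto_reversedG_add`).

The series `S(1, 1)` is evaluated by a case of Lebesgue's identity: `S(1, x) = (1 + xq) S(1, xq²)`
and `S(y, 0) = (1 + yq) S(yq, 0)` give `S(1, 1) = ∏ (1 + q^{2i+1}) ∏ (1 + q^{i+1})`.
With `ψ(q) = f(q, q³)`, Gauss's product `ψ(q) = ∏ (1 - q^{2i+2}) / (1 - q^{2i+1})`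
(`tendsto_gaussProd`), which is the limit of a finite identity of Shanks, turns this into
`S(1, 1) = ψ(q) / ψ(-q)` (`lebesgueSum_mul_ramanujanTheta`). Finally
`ψ(q) = ∑_n q^{2n² - n}`, where the exponent has the parity of `n`, so `ψ(q) + ψ(-q)` is
`2 f(q⁶, q¹⁰)`, and the even limit is
`(S(1, 1) + 1) / 2 = (ψ(q) + ψ(-q)) / (2 ψ(-q)) = f(q⁶, q¹⁰) / ψ(-q)`.

All of this takes place in an arbitrary complete valued field, of characteristic zero where one
divides by two, with a nonzero topologically nilpotent element `q`. All the
identities between series are obtained by telescoping partial sums.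
-/

open Filter Topology Finset

/-! ### Limits and sums in a valued field -/

section Valued

variable {K Γ₀ : Type*} [Field K] [LinearOrderedCommGroupWithZero Γ₀] [Valued K Γ₀]

theorem Valued.tendsto_zero_of_le {ι : Type*} {l : Filter ι} {f g : ι → K}
    (hg : Tendsto g l (𝓝 0)) (h : ∀ i, Valued.v (f i) ≤ Valued.v (g i)) : Tendsto f l (𝓝 0) := by
  intro U hU
  obtain ⟨γ, hγ⟩ := Valued.mem_nhds_zero.1 hU
  have hV : {x : K | Valued.v.restrict x < γ.1} ∈ 𝓝 (0 : K) :=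
    Valued.mem_nhds_zero.2 ⟨γ, subset_rfl⟩
  change ∀ᶠ i in l, f i ∈ U
  filter_upwards [hg.eventually hV] with i hi
  exact hγ (lt_of_le_of_lt ((Valuation.restrict_le_iff _).2 (h i)) hi)

theorem Valued.nonarchimedeanAddGroup : NonarchimedeanAddGroup K where
  is_nonarchimedean U hU := by
    obtain ⟨γ, hγ⟩ := Valued.mem_nhds_zero.1 hU
    exact ⟨⟨Valued.v.restrict.ltAddSubgroup γ, Valued.isOpen_ball K γ.1⟩, hγ⟩

theorem Valued.summable_of_tendsto [CompleteSpace K] {ι : Type*} {f : ι → K}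
    (hf : Tendsto f cofinite (𝓝 0)) : Summable f :=
  have : NonarchimedeanAddGroup K := Valued.nonarchimedeanAddGroup
  NonarchimedeanAddGroup.summable_of_tendsto_cofinite_zero hf

theorem Valued.isClosed_setOf_le (a : K) : IsClosed {x : K | Valued.v x ≤ Valued.v a} := by
  simpa [Valuation.restrict_le_iff] using Valued.isClosed_closedBall K (Valued.v.restrict a)

theorem Valued.hasSum_le {ι : Type*} {f : ι → K} {b a : K} (hf : HasSum f b)
    (h : ∀ i, Valued.v (f i) ≤ Valued.v a) : Valued.v b ≤ Valued.v a :=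
  (Valued.isClosed_setOf_le a).mem_of_tendsto hf
    (Eventually.of_forall fun _ => Valuation.map_sum_le _ fun i _ => h i)

theorem IsTopologicallyNilpotent.valued_lt_one {q : K} (hq : IsTopologicallyNilpotent q) :
    Valued.v q < 1 := by
  by_contra! h
  have h1 : Tendsto (fun _ : ℕ => (1 : K)) atTop (𝓝 0) :=
    Valued.tendsto_zero_of_le hq fun n => by
      rw [map_one, map_pow]; exact one_le_pow₀ h
  exact one_ne_zero (tendsto_nhds_unique tendsto_const_nhds h1)

theorem IsTopologicallyNilpotent.neg_of_valued {q : K} (hq : IsTopologicallyNilpotent q) :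
    IsTopologicallyNilpotent (-q) :=
  Valued.tendsto_zero_of_le hq fun n => by simp

theorem Valued.tendsto_mul_pow {q : K} (hq : IsTopologicallyNilpotent q) {f : ℕ → K} {e : ℕ → ℕ}
    (he : ∀ n, n ≤ e n) (hf : ∀ n, Valued.v (f n) ≤ 1) :
    Tendsto (fun n => f n * q ^ e n) atTop (𝓝 0) := by
  refine Valued.tendsto_zero_of_le hq fun n => ?_
  rw [map_mul, map_pow, map_pow]
  exact (mul_le_of_le_one_left' (hf n)).trans
    (pow_le_pow_right_of_le_one' hq.valued_lt_one.le (he n))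

theorem Valued.v_one_sub_pow {q : K} (hq : Valued.v q < 1) (k : ℕ) :
    Valued.v (1 - q ^ (k + 1)) = 1 := by
  rw [Valuation.map_one_sub_of_lt]
  rw [map_pow]
  exact pow_lt_one' hq (by omega)

theorem Valued.one_sub_pow_ne_zero {q : K} (hq : Valued.v q < 1) (k : ℕ) :
    1 - q ^ (k + 1) ≠ 0 := by
  intro h
  have := Valued.v_one_sub_pow hq k
  simp [h] at this

end Valued

/-! ### A series of Lebesgue and its product expansion -/

section Series

variable {K Γ₀ : Type*} [Field K] [LinearOrderedCommGroupWithZero Γ₀] [Valued K Γ₀]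

/-- The term `y ^ k * q ^ (k(k+1)/2) * (-x; q)_k / (q; q)_k`, written as a product of `k` factors so
that no triangular exponent occurs. -/
def lebesgueTerm (q y x : K) (k : ℕ) : K :=
  ∏ i ∈ range k, y * q ^ (i + 1) * (1 + x * q ^ i) / (1 - q ^ (i + 1))

/-- The series `S(y, x) = ∑_k y ^ k * q ^ (k(k+1)/2) * (-x; q)_k / (q; q)_k`. -/
noncomputable def lebesgueSum (q y x : K) : K := ∑' k, lebesgueTerm q y x k

theorem lebesgueTerm_succ (q y x : K) (k : ℕ) : lebesgueTerm q y x (k + 1) =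
    lebesgueTerm q y x k * (y * q ^ (k + 1) * (1 + x * q ^ k) / (1 - q ^ (k + 1))) :=
  prod_range_succ _ _

theorem lebesgueTerm_zero (q y x : K) : lebesgueTerm q y x 0 = 1 := prod_range_zero _

theorem lebesgueTerm_mul_left (q y x : K) (k : ℕ) :
    lebesgueTerm q (y * q) x k = q ^ k * lebesgueTerm q y x k := by
  induction k with
  | zero => simp [lebesgueTerm_zero]
  | succ k ih => rw [lebesgueTerm_succ, ih, lebesgueTerm_succ]; ring

theorem lebesgueTerm_mul_right (q y x : K) (k : ℕ) :
    (1 + x) * lebesgueTerm q y (x * q) k = lebesgueTerm q y x k * (1 + x * q ^ k) := by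
  induction k with
  | zero => simp [lebesgueTerm_zero]
  | succ k ih =>
    rw [lebesgueTerm_succ, ← mul_assoc, ih, lebesgueTerm_succ]; ring

variable {q y x : K}

theorem Valued.v_one_add_mul_le_one {a b : K} (ha : Valued.v a ≤ 1) (hb : Valued.v b ≤ 1) :
    Valued.v (1 + a * b) ≤ 1 :=
  Valuation.map_add_le _ (by simp) (by rw [map_mul]; exact mul_le_one' ha hb)

theorem lebesgueFactor_le (hq : Valued.v q < 1) (hx : Valued.v x ≤ 1) (i : ℕ) :
    Valued.v (y * q ^ (i + 1) * (1 + x * q ^ i) / (1 - q ^ (i + 1))) ≤ Valued.v (y * q) := by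
  have h1 : Valued.v (q ^ i) ≤ 1 := by rw [map_pow]; exact pow_le_one' hq.le _
  rw [map_div₀, Valued.v_one_sub_pow hq, div_one, pow_succ', map_mul, ← mul_assoc, map_mul]
  exact mul_le_of_le_one_right'
    (Valued.v_one_add_mul_le_one hx h1) |>.trans (mul_le_of_le_one_right' h1)

theorem lebesgueTerm_le (hq : Valued.v q < 1) (hx : Valued.v x ≤ 1) (k : ℕ) :
    Valued.v (lebesgueTerm q y x k) ≤ Valued.v (y * q) ^ k := by
  induction k with
  | zero => simp [lebesgueTerm_zero]
  | succ k ih =>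
    rw [lebesgueTerm_succ, map_mul, pow_succ (Valued.v (y * q))]
    exact mul_le_mul' ih (lebesgueFactor_le hq hx k)

theorem lebesgueTerm_le_one (hq : Valued.v q < 1) (hy : Valued.v y ≤ 1) (hx : Valued.v x ≤ 1)
    (k : ℕ) : Valued.v (lebesgueTerm q y x k) ≤ 1 :=
  (lebesgueTerm_le hq hx k).trans
    (pow_le_one' (by rw [map_mul]; exact mul_le_one' hy hq.le) _)

theorem tendsto_lebesgueTerm (hq : IsTopologicallyNilpotent q) (hy : Valued.v y ≤ 1)
    (hx : Valued.v x ≤ 1) : Tendsto (lebesgueTerm q y x) atTop (𝓝 0) := by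
  refine Valued.tendsto_zero_of_le hq fun k => (lebesgueTerm_le hq.valued_lt_one hx k).trans ?_
  rw [map_pow, map_mul]
  exact pow_le_pow_left' (mul_le_of_le_one_left' hy) k

/-- A series whose partial sums have a closed form tending to zero has sum zero. It is
applied to the termwise difference of the two sides of a functional equation. -/
theorem HasSum.eq_zero_of_sum_range {f g : ℕ → K} {a : K} (h : HasSum f a)
    (hfg : ∀ n, ∑ k ∈ range (n + 1), f k = g n) (hg : Tendsto g atTop (𝓝 0)) : a = 0 :=
  tendsto_nhds_unique ((tendsto_add_atTop_iff_nat 1).2 h.tendsto_sum_nat)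
    (by simpa only [hfg] using hg)

theorem v_mul_pow_le_one {a : K} (hq : Valued.v q < 1) (ha : Valued.v a ≤ 1) (n : ℕ) :
    Valued.v (a * q ^ n) ≤ 1 := by
  rw [map_mul, map_pow]; exact mul_le_one' ha (pow_le_one' hq.le _)

variable [CompleteSpace K]

theorem hasSum_lebesgueSum (hq : IsTopologicallyNilpotent q) (hy : Valued.v y ≤ 1)
    (hx : Valued.v x ≤ 1) : HasSum (lebesgueTerm q y x) (lebesgueSum q y x) :=
  (Valued.summable_of_tendsto
    (by rw [Nat.cofinite_eq_atTop]; exact tendsto_lebesgueTerm hq hy hx)).hasSum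

/-- The functional equation that makes `S(1, x)` an infinite product: the partial sums of the
difference of the two sides telescope to `-x q ^ (n+1)` times a term of `S(1, xq)`. -/
theorem lebesgueSum_one_right_shift (hq : IsTopologicallyNilpotent q) (hx : Valued.v x ≤ 1) :
    lebesgueSum q 1 x = (1 + x * q) * lebesgueSum q 1 (x * q ^ 2) := by
  have hv := hq.valued_lt_one
  have h1 : Valued.v (1 : K) ≤ 1 := by simp
  have hxq : Valued.v (x * q) ≤ 1 := by simpa using v_mul_pow_le_one hv hx 1
  have h := (hasSum_lebesgueSum hq h1 hx).sub
    ((hasSum_lebesgueSum hq h1 (v_mul_pow_le_one hv hx 2)).mul_left (1 + x * q))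
  refine sub_eq_zero.1 (h.eq_zero_of_sum_range
    (g := fun n => -x * lebesgueTerm q 1 (x * q) n * q ^ (n + 1)) (fun n => ?_) ?_)
  · have e (k : ℕ) : (1 + x * q) * lebesgueTerm q 1 (x * q ^ 2) k =
        lebesgueTerm q 1 (x * q) k * (1 + x * q * q ^ k) := by
      rw [← lebesgueTerm_mul_right, pow_two, mul_assoc]
    simp only [e]
    induction n with
    | zero => simp [lebesgueTerm_zero]
    | succ n ih =>
      have hne := Valued.one_sub_pow_ne_zero hv n
      rw [sum_range_succ, ih, lebesgueTerm_succ _ _ x, lebesgueTerm_succ _ _ (x * q)]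
      have e' := lebesgueTerm_mul_right q 1 x n
      generalize lebesgueTerm q 1 (x * q) n = A at *
      generalize lebesgueTerm q 1 x n = B at *
      have : B * (1 * q ^ (n + 1) * (1 + x * q ^ n) / (1 - q ^ (n + 1))) =
        (1 + x) * A * (q ^ (n + 1) / (1 - q ^ (n + 1))) := by rw [e']; ring
      rw [this]
      field_simp
      ring
  · exact Valued.tendsto_mul_pow hq (fun n => Nat.le_succ n) fun n => by
      rw [map_mul, Valuation.map_neg]
      exact mul_le_one' hx (lebesgueTerm_le_one hv h1 hxq n)

/-- Euler's functional equation; iterating it gives the product `∏ (1 + y q ^ (i+1))` for `S(y, 0)`. -/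
theorem lebesgueSum_zero_left_shift (hq : IsTopologicallyNilpotent q) (hy : Valued.v y ≤ 1) :
    lebesgueSum q y 0 = (1 + y * q) * lebesgueSum q (y * q) 0 := by
  have hv := hq.valued_lt_one
  have h0 : Valued.v (0 : K) ≤ 1 := by simp
  have hyq : Valued.v (y * q) ≤ 1 := by simpa using v_mul_pow_le_one hv hy 1
  have h := (hasSum_lebesgueSum hq hy h0).sub
    ((hasSum_lebesgueSum hq hyq h0).mul_left (1 + y * q))
  refine sub_eq_zero.1 (h.eq_zero_of_sum_range
    (g := fun n => -y * lebesgueTerm q y 0 n * q ^ (n + 1)) (fun n => ?_) ?_)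
  · simp only [lebesgueTerm_mul_left]
    induction n with
    | zero => simp [lebesgueTerm_zero]
    | succ n ih =>
      have hne := Valued.one_sub_pow_ne_zero hv n
      rw [sum_range_succ, ih, lebesgueTerm_succ]
      field_simp
      ring
  · exact Valued.tendsto_mul_pow hq (fun n => Nat.le_succ n) fun n => by
      rw [map_mul, Valuation.map_neg]
      exact mul_le_one' hy (lebesgueTerm_le_one hv hy h0 n)

/-- The second-order recursion in `y` that is adjoint to the recursion of the dimer model. -/
theorem lebesgueSum_one_left_shift (hq : IsTopologicallyNilpotent q) (hy : Valued.v y ≤ 1) :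
    lebesgueSum q y 1 - lebesgueSum q (y * q) 1 =
      y * q * (lebesgueSum q (y * q) 1 + lebesgueSum q (y * q * q) 1) := by
  have hv := hq.valued_lt_one
  have h1 : Valued.v (1 : K) ≤ 1 := by simp
  have hyq : Valued.v (y * q) ≤ 1 := by simpa using v_mul_pow_le_one hv hy 1
  have hyq2 : Valued.v (y * q * q) ≤ 1 := by simpa using v_mul_pow_le_one hv hyq 1
  have s0 := hasSum_lebesgueSum hq hy h1
  have s1 := hasSum_lebesgueSum hq hyq h1
  have s2 := hasSum_lebesgueSum hq hyq2 h1
  refine sub_eq_zero.1 (((s0.sub s1).sub ((s1.add s2).mul_left (y * q))).eq_zero_of_sum_range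
    (g := fun n => -y * (1 + q ^ n) * lebesgueTerm q y 1 n * q ^ (n + 1))
    (fun n => ?_) ?_)
  · simp only [lebesgueTerm_mul_left]
    induction n with
    | zero => simp [lebesgueTerm_zero]; ring
    | succ n ih =>
      have hne := Valued.one_sub_pow_ne_zero hv n
      rw [sum_range_succ, ih, lebesgueTerm_succ]
      field_simp
      ring
  · refine Valued.tendsto_mul_pow hq (fun n => by omega) fun n => ?_
    rw [map_mul, map_mul, Valuation.map_neg]
    refine mul_le_one' (mul_le_one' hy ?_) (lebesgueTerm_le_one hv hy h1 n)
    simpa using Valued.v_one_add_mul_le_one h1 (a := 1) (b := q ^ n)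
      (by rw [map_pow]; exact pow_le_one' hv.le _)

theorem v_lebesgueSum_sub_one_le (hq : IsTopologicallyNilpotent q) (hy : Valued.v y ≤ 1)
    (hx : Valued.v x ≤ 1) : Valued.v (lebesgueSum q y x - 1) ≤ Valued.v (y * q) := by
  have hv := hq.valued_lt_one
  have h : HasSum (fun k => lebesgueTerm q y x (k + 1)) (lebesgueSum q y x - 1) := by
    simpa [lebesgueTerm_zero] using
      (hasSum_nat_add_iff' (f := lebesgueTerm q y x) 1).2 (hasSum_lebesgueSum hq hy hx)
  refine Valued.hasSum_le h fun k => (lebesgueTerm_le hv hx _).trans ?_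
  rw [pow_succ]
  exact mul_le_of_le_one_left' (pow_le_one' (by rw [map_mul]; exact mul_le_one' hy hv.le) _)

theorem v_lebesgueSum_sub_zero_le (hq : IsTopologicallyNilpotent q) (hy : Valued.v y ≤ 1)
    (hx : Valued.v x ≤ 1) :
    Valued.v (lebesgueSum q y x - lebesgueSum q y 0) ≤ Valued.v x := by
  have hv := hq.valued_lt_one
  have h0 : Valued.v (0 : K) ≤ 1 := by simp
  refine Valued.hasSum_le ((hasSum_lebesgueSum hq hy hx).sub (hasSum_lebesgueSum hq hy h0))
    fun k => ?_
  induction k with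
  | zero => simp [lebesgueTerm_zero]
  | succ k ih =>
    have hk : Valued.v (q ^ k) ≤ 1 := by rw [map_pow]; exact pow_le_one' hv.le _
    set A := y * q ^ (k + 1) / (1 - q ^ (k + 1))
    have hA : Valued.v A ≤ 1 := by
      rw [map_div₀, Valued.v_one_sub_pow hv, div_one]; exact v_mul_pow_le_one hv hy _
    have e : lebesgueTerm q y x (k + 1) - lebesgueTerm q y 0 (k + 1) =
        (lebesgueTerm q y x k - lebesgueTerm q y 0 k) * A +
          x * (q ^ k * A * lebesgueTerm q y x k) := by
      rw [lebesgueTerm_succ, lebesgueTerm_succ]; simp only [A]; ring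
    rw [e]
    refine Valuation.map_add_le _ ?_ ?_
    · rw [map_mul]; exact (mul_le_of_le_one_right' hA).trans ih
    · rw [map_mul, map_mul, map_mul]
      exact mul_le_of_le_one_right'
        (mul_le_one' (mul_le_one' hk hA) (lebesgueTerm_le_one hv hy hx k))

theorem tendsto_lebesgueSum_left (hq : IsTopologicallyNilpotent q) (hx : Valued.v x ≤ 1) :
    Tendsto (fun n : ℕ => lebesgueSum q (q ^ n) x) atTop (𝓝 1) := by
  have hv := hq.valued_lt_one
  refine tendsto_sub_nhds_zero_iff.1 (Valued.tendsto_zero_of_le hq fun n => ?_)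
  have hy : Valued.v (q ^ n) ≤ 1 := by rw [map_pow]; exact pow_le_one' hv.le _
  refine (v_lebesgueSum_sub_one_le hq hy hx).trans ?_
  rw [map_mul]; exact mul_le_of_le_one_right' hv.le

theorem tendsto_prod_one_add_pow (hq : IsTopologicallyNilpotent q) :
    Tendsto (fun n => ∏ i ∈ range n, (1 + q ^ (i + 1))) atTop (𝓝 (lebesgueSum q 1 0)) := by
  have hv := hq.valued_lt_one
  have h0 : Valued.v (0 : K) ≤ 1 := by simp
  have e (n : ℕ) : (∏ i ∈ range n, (1 + q ^ (i + 1))) * lebesgueSum q (q ^ n) 0 =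
      lebesgueSum q 1 0 := by
    induction n with
    | zero => simp
    | succ n ih =>
      rw [prod_range_succ, mul_assoc, ← ih, lebesgueSum_zero_left_shift hq (y := q ^ n), pow_succ]
      rw [map_pow]; exact pow_le_one' hv.le _
  have h := (tendsto_const_nhds (x := lebesgueSum q 1 0)).div
    (tendsto_lebesgueSum_left hq h0) one_ne_zero
  rw [div_one] at h
  refine h.congr' ?_
  filter_upwards [(tendsto_lebesgueSum_left hq h0).eventually_ne one_ne_zero] with n hn
  rw [Pi.div_apply, ← e n, mul_div_cancel_right₀ _ hn]

theorem lebesgueSum_ne_zero (hq : IsTopologicallyNilpotent q) (hx : Valued.v x ≤ 1) :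
    lebesgueSum q 1 x ≠ 0 := by
  intro h
  have := v_lebesgueSum_sub_one_le hq (y := 1) (by simp) hx
  rw [h, one_mul, zero_sub, Valuation.map_neg, map_one] at this
  exact this.not_gt hq.valued_lt_one

/-- The functional equation `S(1, x) = (1 + xq) S(1, xq²)`, iterated from `x = 1`, expresses
`S(1, 1)` as this product times `S(1, 0)`. -/
theorem tendsto_prod_one_add_pow_odd (hq : IsTopologicallyNilpotent q) :
    Tendsto (fun n => ∏ i ∈ range n, (1 + q ^ (2 * i + 1))) atTop
      (𝓝 (lebesgueSum q 1 1 / lebesgueSum q 1 0)) := by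
  have hv := hq.valued_lt_one
  have h1 : Valued.v (1 : K) ≤ 1 := by simp
  have hp (n : ℕ) : Valued.v (q ^ n) ≤ 1 := by rw [map_pow]; exact pow_le_one' hv.le _
  have e (n : ℕ) : (∏ i ∈ range n, (1 + q ^ (2 * i + 1))) * lebesgueSum q 1 (q ^ (2 * n)) =
      lebesgueSum q 1 1 := by
    induction n with
    | zero => simp
    | succ n ih =>
      rw [prod_range_succ, mul_assoc, ← ih, lebesgueSum_one_right_shift hq (hp (2 * n)), ← pow_add,
        pow_succ, mul_add]
  have h : Tendsto (fun n => lebesgueSum q 1 (q ^ (2 * n))) atTop (𝓝 (lebesgueSum q 1 0)) := by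
    refine tendsto_sub_nhds_zero_iff.1 (Valued.tendsto_zero_of_le hq fun n => ?_)
    refine (v_lebesgueSum_sub_zero_le hq h1 (hp _)).trans ?_
    rw [two_mul, pow_add, map_mul]
    exact mul_le_of_le_one_left' (hp n)
  refine ((tendsto_const_nhds (x := lebesgueSum q 1 1)).div h
    (lebesgueSum_ne_zero hq (by simp))).congr fun n => ?_
  rw [Pi.div_apply, ← e n, mul_div_cancel_right₀ _ (lebesgueSum_ne_zero hq (hp _))]

end Series

/-! ### Gauss's product for the theta function and its even part -/

section Theta

variable {K Γ₀ : Type*} [Field K] [LinearOrderedCommGroupWithZero Γ₀] [Valued K Γ₀] {q : K}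

theorem ramanujanThetaTerm_pow_pow (hq : q ≠ 0) (a b : ℕ) (n : ℤ) :
    ramanujanThetaTerm (q ^ a) (q ^ b) n =
      q ^ (a * (n * (n + 1) / 2) + b * (n * (n - 1) / 2)) := by
  rw [ramanujanThetaTerm, zpow_add₀ hq, zpow_mul, zpow_mul, zpow_natCast, zpow_natCast]

theorem Int.two_mul_mul_succ_ediv_two (n : ℤ) : 2 * (n * (n + 1) / 2) = n * (n + 1) :=
  Int.mul_ediv_cancel' (Int.even_mul_succ_self n).two_dvd

theorem Int.two_mul_mul_pred_ediv_two (n : ℤ) : 2 * (n * (n - 1) / 2) = n * (n - 1) :=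
  Int.mul_ediv_cancel' (Int.even_mul_pred_self n).two_dvd

theorem ramanujanThetaTerm_one_three (hq : q ≠ 0) (n : ℤ) :
    ramanujanThetaTerm q (q ^ 3) n = q ^ (2 * n ^ 2 - n) := by
  have := ramanujanThetaTerm_pow_pow hq 1 3 n
  rw [pow_one] at this
  rw [this]
  congr 1
  push_cast
  linarith [Int.two_mul_mul_succ_ediv_two n, Int.two_mul_mul_pred_ediv_two n]

theorem ramanujanThetaTerm_six_ten (hq : q ≠ 0) (n : ℤ) :
    ramanujanThetaTerm (q ^ 6) (q ^ 10) n = q ^ (2 * (2 * n) ^ 2 - 2 * n) := by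
  rw [ramanujanThetaTerm_pow_pow hq]
  congr 1
  push_cast
  linarith [Int.two_mul_mul_succ_ediv_two n, Int.two_mul_mul_pred_ediv_two n]

/-- The partial products `∏_{1 ≤ i ≤ n} (1 - q ^ (2i)) / (1 - q ^ (2i-1))` of Gauss's product for
`∑_k q ^ (k(k+1)/2)`. -/
def gaussProd (q : K) (n : ℕ) : K :=
  ∏ i ∈ range n, (1 - q ^ (2 * i + 2)) / (1 - q ^ (2 * i + 1))

theorem v_gaussProd (hq : Valued.v q < 1) (n : ℕ) : Valued.v (gaussProd q n) = 1 := by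
  rw [gaussProd, map_prod]
  refine prod_eq_one fun i _ => ?_
  rw [map_div₀, Valued.v_one_sub_pow hq, Valued.v_one_sub_pow hq, div_one]

theorem gaussProd_ne_zero (hq : Valued.v q < 1) (n : ℕ) : gaussProd q n ≠ 0 := by
  intro h
  simpa [h] using v_gaussProd hq n

theorem gaussProd_succ (q : K) (n : ℕ) : gaussProd q (n + 1) =
    gaussProd q n * ((1 - q ^ (2 * n + 2)) / (1 - q ^ (2 * n + 1))) := prod_range_succ _ _

/-- Replacing `n` by `n + 1` in the first `m` terms of the right-hand side of `shanks_identity`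
changes them by a sum that telescopes in `s`. -/
theorem shanks_telescope (hq : Valued.v q < 1) (n m : ℕ) :
    ∑ s ∈ range m, (gaussProd q (n + 1) / gaussProd q s * q ^ (s * (2 * n + 3)) -
      gaussProd q n / gaussProd q s * q ^ (s * (2 * n + 1))) =
    gaussProd q n / gaussProd q m * q ^ (m * (2 * n + 1)) *
      ((1 - q ^ (2 * m)) / (1 - q ^ (2 * n + 1))) := by
  have h0 := Valued.one_sub_pow_ne_zero hq (2 * n)
  induction m with
  | zero => simp
  | succ m ih =>
    have h1 := Valued.one_sub_pow_ne_zero hq (2 * m)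
    have h2 := Valued.one_sub_pow_ne_zero hq (2 * m + 1)
    have h3 := gaussProd_ne_zero hq m
    rw [sum_range_succ, ih, gaussProd_succ, gaussProd_succ]
    rw [add_assoc, one_add_one_eq_two] at h2
    field_simp
    ring

/-- Shanks's finite form of Gauss's identity `∑_k q ^ (k(k+1)/2) = ∏_i (1 - q^{2i}) / (1 - q^{2i-1})`.
The terms with `k` even and `k` odd are paired on the left. On the right the term `s = 0` is the
partial product, and the others tend to zero with `n`. -/
theorem shanks_identity (hq : Valued.v q < 1) (n : ℕ) :
    ∑ k ∈ range n, (q ^ (2 * k ^ 2 + k) + q ^ (2 * k ^ 2 + 3 * k + 1)) =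
      ∑ s ∈ range n, gaussProd q n / gaussProd q s * q ^ (s * (2 * n + 1)) := by
  induction n with
  | zero => simp
  | succ n ih =>
    have h0 := Valued.one_sub_pow_ne_zero hq (2 * n)
    have h3 := gaussProd_ne_zero hq n
    have := shanks_telescope hq n n
    rw [sum_sub_distrib, sub_eq_iff_eq_add] at this
    rw [sum_range_succ, ih, sum_range_succ, show 2 * (n + 1) + 1 = 2 * n + 3 by ring, this,
      gaussProd_succ]
    field_simp
    ring

variable [CompleteSpace K]

theorem summable_pow_of_le (hq : IsTopologicallyNilpotent q) {e : ℕ → ℕ} (he : ∀ n, n ≤ e n) :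
    Summable fun n => q ^ e n := by
  refine Valued.summable_of_tendsto ?_
  rw [Nat.cofinite_eq_atTop]
  simpa using Valued.tendsto_mul_pow hq (f := fun _ => 1) he (by simp)

/-- The sum over `ℤ` is split into the indices `-n` and `n + 1` with `n ≥ 0`, whose exponents are the
triangular numbers of even and of odd index. -/
theorem hasSum_ramanujanTheta_one_three (hq : IsTopologicallyNilpotent q) (hq0 : q ≠ 0) :
    HasSum (ramanujanThetaTerm q (q ^ 3))
      (∑' n, q ^ (2 * n ^ 2 + n) + ∑' n, q ^ (2 * n ^ 2 + 3 * n + 1)) := by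
  have h1 := (summable_pow_of_le hq (e := fun n => 2 * n ^ 2 + n) fun n => by omega).hasSum
  have h2 := (summable_pow_of_le hq (e := fun n => 2 * n ^ 2 + 3 * n + 1) fun n => by omega).hasSum
  -- After `n ↦ -n` the nonnegative indices carry the exponents `2 n ^ 2 + n`.
  rw [← (Equiv.neg ℤ).hasSum_iff]
  refine HasSum.of_nat_of_neg_add_one ?_ ?_
  · convert! h1 using 2 with n
    rw [Function.comp_apply, ramanujanThetaTerm_one_three hq0, ← zpow_natCast]
    congr 1
    simp
  · convert! h2 using 2 with n
    rw [Function.comp_apply, ramanujanThetaTerm_one_three hq0, ← zpow_natCast]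
    congr 1
    simp
    ring

/-- Gauss's product formula `f(q, q³) = ∏_i (1 - q ^ (2i)) / (1 - q ^ (2i-1))`. -/
theorem tendsto_gaussProd (hq : IsTopologicallyNilpotent q) (hq0 : q ≠ 0) :
    Tendsto (gaussProd q) atTop (𝓝 (ramanujanTheta q (q ^ 3))) := by
  have hv := hq.valued_lt_one
  have h1 := (summable_pow_of_le hq (e := fun n => 2 * n ^ 2 + n) fun n => by omega).hasSum
  have h2 := (summable_pow_of_le hq (e := fun n => 2 * n ^ 2 + 3 * n + 1) fun n => by omega).hasSum
  have h := (h1.add h2).tendsto_sum_nat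
  rw [ramanujanTheta, (hasSum_ramanujanTheta_one_three hq hq0).tsum_eq]
  have hd : Tendsto (fun n => ∑ k ∈ range n, (q ^ (2 * k ^ 2 + k) + q ^ (2 * k ^ 2 + 3 * k + 1)) -
      gaussProd q n) atTop (𝓝 0) := by
    rw [← tendsto_add_atTop_iff_nat 1]
    refine Valued.tendsto_zero_of_le hq fun n => ?_
    have h0 : gaussProd q 0 = 1 := prod_range_zero _
    rw [shanks_identity hv, sum_range_succ', zero_mul, pow_zero, mul_one, h0, div_one,
      add_sub_cancel_right]
    refine Valuation.map_sum_le _ fun s _ => ?_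
    rw [map_mul, map_div₀, v_gaussProd hv, v_gaussProd hv, div_one, one_mul, map_pow, map_pow]
    exact pow_le_pow_right_of_le_one' hv.le (by nlinarith)
  simpa using h.sub hd

theorem ramanujanTheta_one_three_ne_zero (hq : IsTopologicallyNilpotent q) (hq0 : q ≠ 0) :
    ramanujanTheta q (q ^ 3) ≠ 0 := by
  intro h
  have h1 := tendsto_gaussProd hq hq0
  rw [h] at h1
  have h2 : Tendsto (fun _ : ℕ => (1 : K)) atTop (𝓝 0) :=
    Valued.tendsto_zero_of_le h1 fun n => by rw [v_gaussProd hq.valued_lt_one, map_one]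
  exact one_ne_zero (tendsto_nhds_unique tendsto_const_nhds h2)

/-- The evaluation `S(1, 1) = ψ(q) / ψ(-q)`, where `ψ(q) = f(q, q³) = ∑_k q ^ (k(k+1)/2)`. -/
theorem lebesgueSum_mul_ramanujanTheta (hq : IsTopologicallyNilpotent q) (hq0 : q ≠ 0) :
    lebesgueSum q 1 1 * ramanujanTheta (-q) ((-q) ^ 3) = ramanujanTheta q (q ^ 3) := by
  have hv := hq.valued_lt_one
  have hv' : Valued.v (q ^ 2) < 1 := by rw [map_pow]; exact pow_lt_one' hv two_ne_zero
  have hE := lebesgueSum_ne_zero hq (x := 0) (by simp)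
  have hplus := tendsto_gaussProd hq hq0
  have hminus := tendsto_gaussProd hq.neg_of_valued (neg_ne_zero.2 hq0)
  have hA := tendsto_prod_one_add_pow hq
  have hO := tendsto_prod_one_add_pow_odd hq
  have hneg (k : ℕ) : (1 : K) - (-q) ^ (2 * k + 2) = 1 - q ^ (2 * k + 2) := by
    rw [Even.neg_pow ⟨k + 1, by ring⟩]
  have hneg' (k : ℕ) : (1 : K) - (-q) ^ (2 * k + 1) = 1 + q ^ (2 * k + 1) := by
    rw [Odd.neg_pow ⟨k, rfl⟩, sub_neg_eq_add]
  have hne (k : ℕ) := Valued.one_sub_pow_ne_zero hv k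
  have hne' (k : ℕ) : 1 + q ^ (2 * k + 1) ≠ 0 := by
    rw [← hneg']; exact Valued.one_sub_pow_ne_zero hq.neg_of_valued.valued_lt_one _
  set R : ℕ → K := fun n => ∏ i ∈ range n, (1 - q ^ (2 * i + 2))
  have hR (n : ℕ) : gaussProd (-q) n * ∏ i ∈ range n, (1 + q ^ (2 * i + 1)) = R n := by
    rw [gaussProd, ← prod_mul_distrib]
    refine prod_congr rfl fun i _ => ?_
    rw [hneg, hneg', div_mul_cancel₀ _ (hne' i)]
  have hRlim : Tendsto R atTop (𝓝 (ramanujanTheta (-q) ((-q) ^ 3) *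
      (lebesgueSum q 1 1 / lebesgueSum q 1 0))) := by
    exact (hminus.mul hO).congr hR
  have hRne (n : ℕ) : R n ≠ 0 := prod_ne_zero_iff.2 fun i _ => hne (2 * i + 1)
  -- A finite form of Euler's `∏ (1 + q ^ i) * ∏ (1 - q ^ (2i-1)) = 1`: up to `R (2 n) / R n → 1`,
  -- the product `gaussProd q n` is `∏ (1 + q ^ i) * R n`.
  have hdbl (n : ℕ) : gaussProd q n * R (2 * n) =
      (∏ i ∈ range (2 * n), (1 + q ^ (i + 1))) * R n * R n := by
    induction n with
    | zero => simp [R, gaussProd]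
    | succ n ih =>
      have := hne (2 * n)
      have hRs (m : ℕ) : R (m + 1) = R m * (1 - q ^ (2 * m + 2)) := prod_range_succ _ _
      rw [show 2 * (n + 1) = 2 * n + 1 + 1 by ring, hRs, hRs, hRs, prod_range_succ,
        prod_range_succ, gaussProd_succ]
      generalize ∏ i ∈ range (2 * n), (1 + q ^ (i + 1)) = A at *
      rw [show gaussProd q n * ((1 - q ^ (2 * n + 2)) / (1 - q ^ (2 * n + 1))) *
          (R (2 * n) * (1 - q ^ (2 * (2 * n) + 2)) * (1 - q ^ (2 * (2 * n + 1) + 2))) =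
        gaussProd q n * R (2 * n) * ((1 - q ^ (2 * n + 2)) / (1 - q ^ (2 * n + 1)) *
          ((1 - q ^ (2 * (2 * n) + 2)) * (1 - q ^ (2 * (2 * n + 1) + 2)))) by ring, ih]
      field_simp
      ring
  have hRL : ramanujanTheta (-q) ((-q) ^ 3) *
      (lebesgueSum q 1 1 / lebesgueSum q 1 0) ≠ 0 :=
    mul_ne_zero (ramanujanTheta_one_three_ne_zero hq.neg_of_valued (neg_ne_zero.2 hq0))
      (div_ne_zero (lebesgueSum_ne_zero hq (by simp)) hE)
  have h2 : Tendsto (fun n : ℕ => 2 * n) atTop atTop :=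
    tendsto_id.const_mul_atTop' two_pos
  have key := tendsto_nhds_unique (hplus.mul (hRlim.comp h2))
    ((((hA.comp h2).mul hRlim).mul hRlim).congr fun n => (hdbl n).symm)
  have := mul_right_cancel₀ hRL key
  rw [this]
  field_simp

/-- In `f(q, q³) + f(-q, -q³)` the terms with odd index cancel, and those with even index `2n` are
twice the terms of `f(q⁶, q¹⁰)`. -/
theorem two_mul_hasSum_ramanujanTheta_six_ten (hq : IsTopologicallyNilpotent q) (hq0 : q ≠ 0) :
    HasSum (fun n => 2 * ramanujanThetaTerm (q ^ 6) (q ^ 10) n)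
      (ramanujanTheta q (q ^ 3) + ramanujanTheta (-q) ((-q) ^ 3)) := by
  have h := (hasSum_ramanujanTheta_one_three hq hq0).summable.hasSum.add
    (hasSum_ramanujanTheta_one_three hq.neg_of_valued (neg_ne_zero.2 hq0)).summable.hasSum
  have hi : Function.Injective fun n : ℤ => 2 * n := fun a b h => by simpa using h
  rw [← hi.hasSum_iff] at h
  · convert! h using 2 with n
    rw [Function.comp_apply, ramanujanThetaTerm_one_three hq0,
      ramanujanThetaTerm_one_three (neg_ne_zero.2 hq0), ramanujanThetaTerm_six_ten hq0,
      Even.neg_zpow ⟨(2 * n) ^ 2 - n, by ring⟩, two_mul]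
  · intro n hn
    have hodd : Odd n := by
      rw [← Int.not_even_iff_odd]
      rintro ⟨k, rfl⟩
      exact hn ⟨k, two_mul k⟩
    rw [ramanujanThetaTerm_one_three hq0, ramanujanThetaTerm_one_three (neg_ne_zero.2 hq0),
      Odd.neg_zpow, add_neg_cancel]
    exact (even_two_mul _).sub_odd hodd

end Theta

/-! ### Transfer relations for dimer configurations -/

section Combinatorics
variable {R : Type*} [CommRing R]

/-- The factor that a site at position `k` contributes to the weight of a state. -/
def siteWeight {m : ℕ} (r s : R) (k : ℕ) : Option (Fin m) → R
  | none => 1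
  | some _ => r * s ^ k

theorem DimerState.weight_eq_prod {n m : ℕ} (r s : R) (d : DimerState n m) :
    d.weight r s = ∏ i : Fin n, siteWeight r s ((i : ℕ) + 1) (d i) := by
  rw [DimerState.weight, DimerState.occupied, ← prod_pow_eq_pow_sum, ← prod_const,
    ← prod_mul_distrib, prod_filter]
  refine prod_congr rfl fun i _ => ?_
  cases d i <;> simp [siteWeight]

theorem DimerState.isConfiguration_snoc {n m : ℕ} (d : DimerState (n + 1) m)
    (β : Option (Fin m)) :
    DimerState.IsConfiguration (n := n + 2) (Fin.snoc d β : DimerState (n + 2) m) ↔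
      d.IsConfiguration ∧ ∀ c, d (Fin.last n) = some c → β ≠ some c := by
  constructor
  · intro h
    refine ⟨fun i j hij c hi => ?_, fun c hc => ?_⟩
    · have := h i.castSucc j.castSucc (by simpa using hij) c
      simp only [Fin.snoc_castSucc] at this
      exact this hi
    · have := h (Fin.last n).castSucc (Fin.last (n + 1)) (by simp) c
      simp only [Fin.snoc_castSucc, Fin.snoc_last] at this
      exact this hc
  · rintro ⟨h, hl⟩ i j hij c
    have hi : (i : ℕ) < n + 1 := by omega
    obtain ⟨i, rfl⟩ : ∃ i' : Fin (n + 1), i = i'.castSucc := ⟨⟨i, hi⟩, rfl⟩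
    induction j using Fin.lastCases with
    | last =>
      have : i = Fin.last n := by ext; simp at hij ⊢; omega
      simp only [Fin.snoc_castSucc, Fin.snoc_last, this]
      exact hl c
    | cast j =>
      simp only [Fin.snoc_castSucc]
      exact h i j (by simpa using hij) c

theorem dimerZ_eq_sum_ite (n m : ℕ) (α β : Option (Fin m)) (r s : R) :
    dimerZ (n + 1) m α β r s = ∑ d : DimerState (n + 1) m,
      if d.IsConfiguration ∧ d 0 = α ∧ d (Fin.last n) = β then d.weight r s else 0 := by
  rw [dimerZ, sum_filter]
  refine sum_congr rfl fun d _ => ?_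
  have h0 : (∀ i : Fin (n + 1), (i : ℕ) = 0 → d i = α) ↔ d 0 = α :=
    ⟨fun h => h 0 rfl, fun h i hi => by rwa [show i = 0 from Fin.ext hi]⟩
  have h1 : (∀ i : Fin (n + 1), (i : ℕ) + 1 = n + 1 → d i = β) ↔ d (Fin.last n) = β :=
    ⟨fun h => h _ rfl, fun h i hi => by
      rwa [show i = Fin.last n from Fin.ext (by simpa using hi)]⟩
  simp only [h0, h1]

theorem dimerZ_one (m : ℕ) (α β : Option (Fin m)) (r s : R) :
    dimerZ 1 m α β r s = if α = β then siteWeight r s 1 α else 0 := by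
  rw [dimerZ_eq_sum_ite, sum_eq_single (fun _ => α)]
  · have : DimerState.IsConfiguration (fun _ => α : DimerState 1 m) := by
      intro i j hij; omega
    simp only [this, true_and, DimerState.weight_eq_prod]
    refine if_congr Iff.rfl ?_ rfl
    exact (Fin.prod_univ_succ _).trans (by simp)
  · intro d _ hd
    rw [if_neg]
    rintro ⟨-, h, -⟩
    exact hd (funext fun i => by rwa [show i = 0 from Fin.ext (by omega)])
  · simp

/-- Transfer relation: removing the last site leaves a configuration whose last site may be in any
state except the colour of the dimer removed. -/
theorem dimerZ_succ (n m : ℕ) (α β : Option (Fin m)) (r s : R) :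
    dimerZ (n + 2) m α β r s = siteWeight r s (n + 2) β *
      ∑ γ : Option (Fin m), if γ = none ∨ γ ≠ β then dimerZ (n + 1) m α γ r s else 0 := by
  have key : ∀ γ β' : Option (Fin m), (∀ c, γ = some c → β' ≠ some c) ↔ (γ = none ∨ γ ≠ β') := by
    intro γ β'
    cases γ <;> simp [eq_comm]
  rw [dimerZ_eq_sum_ite, ← (Fin.snocEquiv fun _ : Fin (n + 2) => Option (Fin m)).sum_comp,
    Fintype.sum_prod_type, sum_eq_single β]
  · simp only [dimerZ_eq_sum_ite]
    have : ∀ γ : Option (Fin m), (if γ = none ∨ γ ≠ β then ∑ d : DimerState (n + 1) m,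
        (if d.IsConfiguration ∧ d 0 = α ∧ d (Fin.last n) = γ then d.weight r s else 0) else 0) =
        ∑ d : DimerState (n + 1) m, if γ = d (Fin.last n) then
          (if (γ = none ∨ γ ≠ β) ∧ d.IsConfiguration ∧ d 0 = α then d.weight r s else 0)
          else 0 := by
      intro γ
      split_ifs with h
      · refine sum_congr rfl fun d _ => ?_
        by_cases h' : γ = d (Fin.last n)
        · subst h'
          simp only [h, true_and, and_true, if_true]
        · simp only [h', Ne.symm h', and_false, if_false]
      · simp [h]
    simp only [this]
    rw [sum_comm, mul_sum]
    refine sum_congr rfl fun d _ => ?_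
    rw [sum_ite_eq' univ (d (Fin.last n))]
    have h0 : (Fin.snoc (α := fun _ => Option (Fin m)) d β : DimerState (n + 2) m) 0 = d 0 := by
      rw [← Fin.castSucc_zero, Fin.snoc_castSucc]
    have hw : DimerState.weight r s
        (Fin.snoc (α := fun _ => Option (Fin m)) d β : DimerState (n + 2) m) =
        siteWeight r s (n + 2) β * DimerState.weight r s d := by
      rw [DimerState.weight_eq_prod, DimerState.weight_eq_prod, Fin.prod_univ_castSucc, mul_comm]
      simp
    have he : Fin.snocEquiv (fun _ : Fin (n + 2) => Option (Fin m)) (β, d) =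
      (Fin.snoc (α := fun _ => Option (Fin m)) d β : DimerState (n + 2) m) := rfl
    simp only [he, DimerState.isConfiguration_snoc, key, h0, hw, Fin.snoc_last,
      mem_univ, if_true, and_true, mul_ite, mul_zero]
    refine if_congr ?_ rfl rfl
    tauto
  · intro γ _ hγ
    refine sum_eq_zero fun d _ => if_neg ?_
    rintro ⟨-, -, h⟩
    simp [Fin.snocEquiv_apply] at h
    exact hγ h
  · simp

end Combinatorics

/-! ### Reversed generating functions with two colours -/

section Reversed
variable {K : Type*} [Field K]

/-- The generating function, with `β` at the last site, of the configurations with two colours whose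
first site is empty or in the state `a` (meant to be a colour), with each configuration
weighted by `q` to the sum of its empty positions. -/
def reversedG (q : K) (a β : Option (Fin 2)) (n : ℕ) : K :=
  q ^ (n * (n + 1) / 2) * (dimerZ n 2 none β 1 q⁻¹ + dimerZ n 2 a β 1 q⁻¹)

theorem Nat.succ_triangle (n : ℕ) : (n + 1) * (n + 1 + 1) / 2 = n * (n + 1) / 2 + (n + 1) := by
  rw [show (n + 1) * (n + 1 + 1) = n * (n + 1) + (n + 1) * 2 by ring,
    Nat.add_mul_div_right _ _ two_pos]

theorem Fintype.sum_option_fin_two {c c' : Fin 2} (h : c ≠ c') (f : Option (Fin 2) → K) :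
    ∑ γ, f γ = f none + f (some c) + f (some c') := by
  rw [Fintype.sum_option, Fin.sum_univ_two, add_assoc]
  fin_cases c <;> fin_cases c' <;> simp_all [add_comm]

theorem reversedG_succ_some {q : K} (hq : q ≠ 0) {c c' : Fin 2} (h : c ≠ c')
    (a : Option (Fin 2)) (n : ℕ) : reversedG q a (some c) (n + 2) =
      reversedG q a none (n + 1) + reversedG q a (some c') (n + 1) := by
  have hz (α) := dimerZ_succ n 2 α (some c) (1 : K) q⁻¹
  simp only [Fintype.sum_option_fin_two h, siteWeight] at hz
  simp only [reversedG, hz, Nat.succ_triangle (n + 1), pow_add q _ (n + 1 + 1)]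
  simp [h.symm]
  field_simp
  ring

theorem reversedG_succ_none {q : K} {c c' : Fin 2} (h : c ≠ c')
    (a : Option (Fin 2)) (n : ℕ) : reversedG q a none (n + 2) =
      q ^ (n + 2) * (reversedG q a none (n + 1) + (reversedG q a (some c) (n + 1) +
        reversedG q a (some c') (n + 1))) := by
  have hz (α) := dimerZ_succ n 2 α none (1 : K) q⁻¹
  simp only [Fintype.sum_option_fin_two h, siteWeight] at hz
  simp only [reversedG, hz, Nat.succ_triangle (n + 1), pow_add q _ (n + 1 + 1)]
  simp
  ring

theorem reversedG_one {q : K} (hq : q ≠ 0) {c c' : Fin 2} (h : c ≠ c') :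
    reversedG q (some c') (some c) 1 = 0 ∧ reversedG q (some c') (some c') 1 = 1 ∧
      reversedG q (some c') none 1 = q := by
  simp [reversedG, dimerZ_one, siteWeight, h.symm, hq]

theorem reversedG_sub {q : K} (hq : q ≠ 0) {c c' : Fin 2} (h : c ≠ c') (n : ℕ) :
    reversedG q (some c') (some c) (n + 1) - reversedG q (some c') (some c') (n + 1) =
      (-1) ^ (n + 1) := by
  induction n with
  | zero => obtain ⟨h1, h2, -⟩ := reversedG_one hq h; simp [h1, h2]
  | succ n ih =>
    rw [reversedG_succ_some hq h, reversedG_succ_some hq h.symm, pow_succ, ← ih]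
    ring

variable {Γ₀ : Type*} [LinearOrderedCommGroupWithZero Γ₀] [Valued K Γ₀]

theorem v_reversedG_le_one {q : K} (hv : Valued.v q < 1) (hq0 : q ≠ 0)
    {c c' : Fin 2} (h : c ≠ c') (n : ℕ) :
    Valued.v (reversedG q (some c') (some c) (n + 1)) ≤ 1 ∧
    Valued.v (reversedG q (some c') (some c') (n + 1)) ≤ 1 ∧
    Valued.v (reversedG q (some c') none (n + 1)) ≤ 1 := by
  induction n with
  | zero => obtain ⟨h1, h2, h3⟩ := reversedG_one hq0 h; simp [h1, h2, h3, hv.le]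
  | succ n ih =>
    obtain ⟨h1, h2, h3⟩ := ih
    rw [reversedG_succ_some hq0 h, reversedG_succ_some hq0 h.symm, reversedG_succ_none h, map_mul,
      map_pow]
    exact ⟨Valuation.map_add_le _ h3 h2, Valuation.map_add_le _ h3 h1,
      mul_le_one' (pow_le_one' hv.le _) (Valuation.map_add_le _ h3 (Valuation.map_add_le _ h1 h2))⟩

variable [CompleteSpace K]

/-- The transfer recursion preserves this linear form because its coefficients solve the adjoint
recursion, by `lebesgueSum_one_left_shift`. -/
theorem reversedG_invariant {q : K} (hq : IsTopologicallyNilpotent q) (hq0 : q ≠ 0)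
    {c c' : Fin 2} (h : c ≠ c') (n : ℕ) :
    lebesgueSum q (q ^ (n + 1)) 1 * (reversedG q (some c') (some c) (n + 1) +
        reversedG q (some c') (some c') (n + 1)) +
      (lebesgueSum q (q ^ (n + 1)) 1 + lebesgueSum q (q ^ (n + 2)) 1) *
        reversedG q (some c') none (n + 1) = lebesgueSum q 1 1 := by
  have hv := hq.valued_lt_one
  have hs (n : ℕ) := lebesgueSum_one_left_shift hq (y := q ^ n)
    (by rw [map_pow]; exact pow_le_one' hv.le _)
  simp only [← pow_succ] at hs
  induction n with
  | zero =>
    obtain ⟨h1, h2, h3⟩ := reversedG_one hq0 h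
    have := hs 0
    simp only [h1, h2, h3, zero_add, pow_zero, pow_one] at this ⊢
    linear_combination -this
  | succ n ih =>
    rw [← ih, reversedG_succ_some hq0 h, reversedG_succ_some hq0 h.symm,
      reversedG_succ_none h]
    linear_combination (-reversedG q (some c') (some c) (n + 1) -
      reversedG q (some c') (some c') (n + 1) - reversedG q (some c') none (n + 1)) * hs (n + 1)

theorem tendsto_reversedG_add {q : K} (hq : IsTopologicallyNilpotent q) (hq0 : q ≠ 0)
    {c c' : Fin 2} (h : c ≠ c') :
    Tendsto (fun n => reversedG q (some c') (some c) n + reversedG q (some c') (some c') n) atTop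
      (𝓝 (lebesgueSum q 1 1)) := by
  have hv := hq.valued_lt_one
  have hC : Tendsto (fun n => reversedG q (some c') none (n + 2)) atTop (𝓝 0) := by
    refine (Valued.tendsto_mul_pow hq (e := fun n => n + 2) (fun n => by omega) fun n => ?_).congr
      fun n => (mul_comm _ _).trans (reversedG_succ_none h _ n).symm
    obtain ⟨h1, h2, h3⟩ := v_reversedG_le_one hv hq0 h n
    exact Valuation.map_add_le _ h3 (Valuation.map_add_le _ h1 h2)
  have ha := tendsto_lebesgueSum_left hq (x := 1) (by simp)
  have ha2 := (tendsto_add_atTop_iff_nat 2).2 ha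
  have ha3 := (tendsto_add_atTop_iff_nat 3).2 ha
  have hl := ((tendsto_const_nhds (x := lebesgueSum q 1 1)).sub ((ha2.add ha3).mul hC)).div ha2
    one_ne_zero
  rw [mul_zero, sub_zero, div_one] at hl
  rw [← tendsto_add_atTop_iff_nat 2]
  refine hl.congr' ?_
  filter_upwards [ha2.eventually_ne one_ne_zero] with n hn
  rw [Pi.div_apply, div_eq_iff hn, ← reversedG_invariant hq hq0 h (n + 1)]
  ring

end Reversed

/-! ### The field of formal Laurent series -/

theorem formalS_ne_zero : formalS ≠ 0 := HahnSeries.single_ne_zero one_ne_zero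

theorem isTopologicallyNilpotent_formalS : IsTopologicallyNilpotent formalS := by
  refine Valued.tendsto_zero_pow_of_v_lt_one ?_
  have := LaurentSeries.valuation_single_zpow ℚ 1
  rw [formalS, this, ← WithZero.exp_zero, WithZero.exp_lt_exp]
  norm_num

/-- The function in question is `A_n = ((A_n + B_n) + (A_n - B_n)) / 2`, and `A_n - B_n = (-1) ^ n`. -/
theorem dimerG2_two_eq {K : Type*} [Field K] [CharZero K] {q : K} (hq : q ≠ 0) {c c' : Fin 2}
    (h : c ≠ c') (n : ℕ) : q ^ ((n + 1) * (n + 1 + 1) / 2) * dimerG2 (n + 1) 2 c c' 1 q⁻¹ =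
      (reversedG q (some c') (some c) (n + 1) + reversedG q (some c') (some c') (n + 1) +
        (-1) ^ (n + 1)) / 2 := by
  rw [← reversedG_sub hq h, dimerG2, reversedG, reversedG]
  push_cast
  ring

/-- The limit along any sequence of sizes of constant parity, `ε` being the sign `(-1) ^ n`. -/
theorem tendsto_dimerG2_two {K Γ₀ : Type*} [Field K] [CharZero K]
    [LinearOrderedCommGroupWithZero Γ₀] [Valued K Γ₀] [CompleteSpace K] {q : K}
    (hq : IsTopologicallyNilpotent q) (hq0 : q ≠ 0) {c c' : Fin 2} (h : c ≠ c') {e : ℕ → ℕ}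
    (he : Tendsto e atTop atTop) {ε : K} (hε : ∀ p, (-1) ^ e p = ε) :
    Tendsto (fun p => q ^ (e p * (e p + 1) / 2) * dimerG2 (e p) 2 c c' 1 q⁻¹) atTop
      (𝓝 (ramanujanTheta (q ^ 6) (q ^ 10) / ramanujanTheta (-q) ((-q) ^ 3) + (ε - 1) / 2)) := by
  have hψ : ramanujanTheta (-q) ((-q) ^ 3) ≠ 0 :=
    ramanujanTheta_one_three_ne_zero hq.neg_of_valued (neg_ne_zero.2 hq0)
  have hev : 2 * ramanujanTheta (q ^ 6) (q ^ 10) =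
      ramanujanTheta q (q ^ 3) + ramanujanTheta (-q) ((-q) ^ 3) := by
    rw [← (two_mul_hasSum_ramanujanTheta_six_ten hq hq0).tsum_eq, tsum_mul_left, ramanujanTheta]
  have hval : ramanujanTheta (q ^ 6) (q ^ 10) / ramanujanTheta (-q) ((-q) ^ 3) + (ε - 1) / 2 =
      (lebesgueSum q 1 1 + ε) / 2 := by
    rw [← lebesgueSum_mul_ramanujanTheta hq hq0] at hev
    generalize ramanujanTheta (-q) ((-q) ^ 3) = ψ at *
    field_simp
    linear_combination hev
  rw [hval]
  refine ((((tendsto_reversedG_add hq hq0 h).comp he).add_const ε).div_const 2).congr' ?_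
  filter_upwards [he.eventually_ge_atTop 1] with p hp
  obtain ⟨n, hn⟩ := Nat.exists_eq_add_of_le' hp
  rw [← hε p, Function.comp_apply, hn, dimerG2_two_eq hq0 h]

instance charZero_laurentSeries_rat : CharZero (LaurentSeries ℚ) :=
  charZero_of_injective_algebraMap (algebraMap ℚ (LaurentSeries ℚ)).injective

theorem mainTheorem8 (c c' : Fin 2) (hcc' : c ≠ c') :
    Summable (ramanujanThetaTerm (formalS ^ 6) (formalS ^ 10)) ∧
    Summable (ramanujanThetaTerm (-formalS) (-formalS ^ 3)) ∧
    ramanujanTheta (-formalS) (-formalS ^ 3) ≠ 0 ∧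
    Filter.Tendsto
      (fun p : ℕ => formalS ^ (2 * p * (2 * p + 1) / 2) * dimerG2 (2 * p) 2 c c' 1 formalS⁻¹)
      Filter.atTop
      (nhds (ramanujanTheta (formalS ^ 6) (formalS ^ 10) /
        ramanujanTheta (-formalS) (-formalS ^ 3))) ∧
    Filter.Tendsto
      (fun p : ℕ => formalS ^ ((2 * p + 1) * (2 * p + 1 + 1) / 2) *
        dimerG2 (2 * p + 1) 2 c c' 1 formalS⁻¹)
      Filter.atTop
      (nhds (ramanujanTheta (formalS ^ 6) (formalS ^ 10) /
        ramanujanTheta (-formalS) (-formalS ^ 3) - 1)) := by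
  have hs := isTopologicallyNilpotent_formalS
  have hs0 := formalS_ne_zero
  have hns0 := neg_ne_zero.2 hs0
  have h2 : Tendsto (fun p : ℕ => 2 * p) atTop atTop := tendsto_id.const_mul_atTop' two_pos
  rw [show -formalS ^ 3 = (-formalS) ^ 3 from (Odd.neg_pow ⟨1, rfl⟩ _).symm]
  refine ⟨?_, (hasSum_ramanujanTheta_one_three hs.neg_of_valued hns0).summable,
    ramanujanTheta_one_three_ne_zero hs.neg_of_valued hns0, ?_, ?_⟩
  · exact (summable_mul_left_iff two_ne_zero).1
      (two_mul_hasSum_ramanujanTheta_six_ten hs hs0).summable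
  · simpa using tendsto_dimerG2_two hs hs0 hcc' h2 (ε := 1) fun p => by simp
  · have := tendsto_dimerG2_two hs hs0 hcc' (tendsto_add_atTop_nat 1 |>.comp h2) (ε := -1)
      fun p => by simp [pow_succ]
    rw [sub_eq_add_neg]
    convert! this using 3
    norm_num
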